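/- Let $M_0,M_1,M_2,M_3\ge 0$ and let $(S_n)_{n\ge0}$ be the sequence of monic polynomials, $\deg S_n=n$, orthogonal with respect to the inner product $$(P,Q)=\int_{\mathbb R}P(x)Q(x)e^{-x^2}\,dx+\sum_{i=0}^{3}M_i\,P^{(i)}(0)\,Q^{(i)}(0)$$ on real polynomials. For $\alpha\in\mathbb R$ let $J_\alpha(z)=\sum_{k\ge0}\frac{(-1)^k}{k!\,\Gamma(k+\alpha+1)}\left(\frac z2\right)^{2k+\alpha}$ be the Bessel function of the first kind of order $\alpha$. (a) (Even degree.) $$\lim_{n\to\infty}\frac{(-1)^n\sqrt n}{n!}\,S_{2n}\!\left(\frac{x}{2\sqrt n}\right)=\begin{cases}\left(\frac x2\right)^{1/2}J_{-1/2}(x)&\text{if }M_0=0,\ M_2=0,\\[2pt]-\left(\frac x2\right)^{1/2}J_{3/2}(x)&\text{if }M_0>0,\ M_2=0,\\[2pt]\left(\frac x2\right)^{1/2}\left[\frac23J_{7/2}(x)-J_{3/2}(x)-\frac23J_{-1/2}(x)\right]&\text{if }M_0=0,\ M_2>0,\\[2pt]\left(\frac x2\right)^{1/2}J_{7/2}(x)&\text{if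 }M_0>0,\ M_2>0.\end{cases}$$ (b) (Odd degree.) $$\lim_{n\to\infty}\frac{(-1)^n}{n!}\,S_{2n+1}\!\left(\frac{x}{2\sqrt n}\right)=\begin{cases}\left(\frac x2\right)^{1/2}J_{1/2}(x)&\text{if }M_1=0,\ M_3=0,\\[2pt]-\left(\frac x2\right)^{1/2}J_{5/2}(x)&\text{if }M_1>0,\ M_3=0,\\[2pt]\left(\frac x2\right)^{1/2}\left[\frac25J_{9/2}(x)-J_{5/2}(x)-\frac25J_{1/2}(x)\right]&\text{if }M_1=0,\ M_3>0,\\[2pt]\left(\frac x2\right)^{1/2}J_{9/2}(x)&\text{if }M_1>0,\ M_3>0.\end{cases}$$ All the limits hold uniformly on compact subsets of $\mathbb C$. Here the same branch of the power is used in $(x/2)^{1/2}$ and in $J_\alpha(x)$, and the right-hand sides, which have a removable singularity at $x=0$, denote the corresponding entire functions. -/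

import Mathlib

open Filter Topology Polynomial

noncomputable section

/-- The discrete Sobolev inner product
`(P, Q) = ∫ P(x) Q(x) exp(-x²) dx + ∑_{i=0}^{3} M_i P^{(i)}(0) Q^{(i)}(0)` on real polynomials. -/
def sobolevInner (M : Fin 4 → ℝ) (P Q : ℝ[X]) : ℝ :=
  (∫ x : ℝ, P.eval x * Q.eval x * Real.exp (-x ^ 2)) +
    ∑ i : Fin 4, M i * (derivative^[(i : ℕ)] P).eval 0 * (derivative^[(i : ℕ)] Q).eval 0

/-- `S` is the sequence of monic orthogonal polynomials (`deg S n = n`) with respect to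
`sobolevInner M`. -/
structure IsMonicOrthogonalSequence (M : Fin 4 → ℝ) (S : ℕ → ℝ[X]) : Prop where
  monic : ∀ n, (S n).Monic
  natDegree_eq : ∀ n, (S n).natDegree = n
  orthogonal : ∀ m n, m ≠ n → sobolevInner M (S m) (S n) = 0

/-- The Bessel function of the first kind of real order `α`,
`J_α(z) = ∑_{k ≥ 0} (-1)^k / (k! Γ(k + α + 1)) (z / 2)^{2k + α}`, with principal powers.
(At a pole of `Γ` the corresponding term is `0`, in agreement with the usual convention for
negative integer orders; for `α < 0` the value at `z = 0` carries no meaning.) -/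
def besselJ (α : ℝ) (z : ℂ) : ℂ :=
  ∑' k : ℕ, ((-1) ^ k / ((k.factorial : ℂ) * (Real.Gamma (k + α + 1) : ℂ))) *
    (z / 2) ^ (((2 * k + α : ℝ)) : ℂ)

/-- The functions `f n` converge, uniformly on compact subsets of `ℂ`, to the entire function given
by the formula `g` away from the origin (the singularity of `g` at `0` being removable). -/
def TendstoUniformlyOnCompactsTo (f : ℕ → ℂ → ℂ) (g : ℂ → ℂ) : Prop :=
  ∃ F : ℂ → ℂ, Differentiable ℂ F ∧ (∀ z : ℂ, z ≠ 0 → F z = g z) ∧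
    ∀ K : Set ℂ, IsCompact K → TendstoUniformlyOn f F atTop K

/-- `(-1)^n √n / n! · S_{2n}(z / (2√n))`. -/
def scaledEven (S : ℕ → ℝ[X]) (n : ℕ) (z : ℂ) : ℂ :=
  ((-1) ^ n * (√(n : ℝ) : ℂ) / (n.factorial : ℂ)) *
    aeval (z / (2 * (√(n : ℝ) : ℂ))) (S (2 * n))

/-- `(-1)^n / n! · S_{2n+1}(z / (2√n))`. -/
def scaledOdd (S : ℕ → ℝ[X]) (n : ℕ) (z : ℂ) : ℂ :=
  ((-1) ^ n / (n.factorial : ℂ)) *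
    aeval (z / (2 * (√(n : ℝ) : ℂ))) (S (2 * n + 1))

end

/-! The weight and the point masses respect parity, so `S (2n)` is `P(x²)` and `S (2n+1)` is `x
P(x²)`. Under `t = x²`, `P` is the monic orthogonal polynomial for `t^α e^{-t}` on `(0, ∞)`, with `α
= -1/2` or `α = 1/2`, plus one mass on `P(0)` and one on `P'(0)`. Uniqueness of monic orthogonal
polynomials (`IsMonicOrthogonalSequence.eq_of_forall_X_pow`) makes it enough to exhibit `P`.

The candidate `laguerreSobolev` combines `L_n^α`, `t L_{n-1}^{α+2}` and `t² L_{n-2}^{α+4}`. By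
Chu-Vandermonde (`laguerreMoment_X_pow_mul_scaledLaguerre`) each of them is orthogonal to `t^j` for
`2 ≤ j < n`, and the powers of `t` see no mass there. Orthogonality to `1` and to `t`, with
monicity, leaves a 3×3 linear system for the coefficients.

As `n → ∞` each positive mass has a diverging normalised size, and the coefficients converge to
limits depending only on which masses vanish (the `connTendsto_*` lemmas). The Mehler-Heine limit
(`tendstoLocallyUniformly_scaledLaguerre`) turns the three Laguerre terms into Bessel functions of
orders `α`, `α+2`, `α+4`; putting `t = z²/4` gives the theorem. -/

noncomputable section

/-! ### Chu-Vandermonde and moments of Laguerre polynomials -/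

/-- An alternating binomial sum of quotients of Gamma values (Chu-Vandermonde). -/
theorem sum_choose_Gamma_div_Gamma (m : ℕ) (s β : ℝ) (hs : 0 < s) (hβ : 0 < β + 1) :
    ∑ k ∈ Finset.range (m + 1),
      (-1) ^ k * (m.choose k : ℝ) * (Real.Gamma (s + k) / Real.Gamma (β + 1 + k)) =
    Real.Gamma s / Real.Gamma (β + 1 + m) * (ascPochhammer ℝ m).eval (β + 1 - s) := by
  induction m generalizing s β with
  | zero => simp
  | succ m ih =>
    -- Pascal's rule: the sum of length `m + 1` is a difference of two sums of length `m`, the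
    -- second with `s` and `β` both raised by one, which leaves `β + 1 - s` unchanged.
    have key : ∑ k ∈ Finset.range (m + 1 + 1), (-1) ^ k * ((m + 1).choose k : ℝ) *
          (Real.Gamma (s + k) / Real.Gamma (β + 1 + k)) =
        ∑ k ∈ Finset.range (m + 1), (-1) ^ k * (m.choose k : ℝ) *
          (Real.Gamma (s + k) / Real.Gamma (β + 1 + k)) -
        ∑ k ∈ Finset.range (m + 1), (-1) ^ k * (m.choose k : ℝ) *
          (Real.Gamma (s + 1 + k) / Real.Gamma (β + 1 + 1 + k)) := by
      have h1 : ∑ k ∈ Finset.range (m + 1), (-1) ^ k * (m.choose k : ℝ) *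
          (Real.Gamma (s + k) / Real.Gamma (β + 1 + k)) =
          ∑ k ∈ Finset.range (m + 1 + 1), (-1) ^ k * (m.choose k : ℝ) *
          (Real.Gamma (s + k) / Real.Gamma (β + 1 + k)) := by
        rw [Finset.sum_range_succ _ (m + 1)]
        simp
      rw [h1, Finset.sum_range_succ', Finset.sum_range_succ' _ (m + 1), add_sub_right_comm,
        ← Finset.sum_sub_distrib]
      congr 1
      · refine Finset.sum_congr rfl fun k _ => ?_
        rw [Nat.choose_succ_succ, show s + 1 + (k : ℝ) = s + ((k + 1 : ℕ) : ℝ) by push_cast; ring,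
          show β + 1 + 1 + (k : ℝ) = β + 1 + ((k + 1 : ℕ) : ℝ) by push_cast; ring]
        push_cast
        ring
      · simp
    have hm : (0 : ℝ) ≤ m := m.cast_nonneg
    rw [key, ih s β hs hβ, ih (s + 1) (β + 1) (by linarith) (by linarith),
      Real.Gamma_add_one hs.ne', show β + 1 + ((m + 1 : ℕ) : ℝ) = (β + 1 + m) + 1 by push_cast; ring,
      show β + 1 + 1 + (m : ℝ) = (β + 1 + m) + 1 by ring,
      Real.Gamma_add_one (by positivity : (β + 1 + m : ℝ) ≠ 0), ascPochhammer_succ_eval,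
      show β + 1 + 1 - (s + 1) = β + 1 - s by ring]
    have := (Real.Gamma_pos_of_pos (by positivity : (0 : ℝ) < β + 1 + m)).ne'
    have : (β + 1 + m : ℝ) ≠ 0 := by positivity
    field_simp
    ring

/-- The moment functional of the Laguerre weight `t ^ α * exp (-t)` on `(0, ∞)`. -/
def laguerreMoment (α : ℝ) : ℝ[X] →ₗ[ℝ] ℝ :=
  Polynomial.lsum fun k => LinearMap.mulRight ℝ (Real.Gamma (α + 1 + k))

@[simp] theorem laguerreMoment_monomial (α : ℝ) (k : ℕ) (c : ℝ) :
    laguerreMoment α (monomial k c) = c * Real.Gamma (α + 1 + k) := by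
  simp [laguerreMoment, Polynomial.lsum_apply, Polynomial.sum_monomial_index]

/-- The Laguerre polynomial `L_m^β` up to a constant factor. -/
def scaledLaguerre (β : ℝ) (m : ℕ) : ℝ[X] :=
  ∑ k ∈ Finset.range (m + 1), monomial k ((-1) ^ k * (m.choose k : ℝ) / Real.Gamma (β + 1 + k))

theorem scaledLaguerre_coeff (β : ℝ) (m k : ℕ) :
    (scaledLaguerre β m).coeff k = (-1) ^ k * (m.choose k : ℝ) / Real.Gamma (β + 1 + k) := by
  simp only [scaledLaguerre, finsetSum_coeff, coeff_monomial, Finset.sum_ite_eq',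
    Finset.mem_range]
  split_ifs with h
  · rfl
  · rw [Nat.choose_eq_zero_of_lt (by omega)]
    simp

theorem scaledLaguerre_natDegree_le (β : ℝ) (m : ℕ) : (scaledLaguerre β m).natDegree ≤ m := by
  rw [natDegree_le_iff_coeff_eq_zero]
  intro k hk
  rw [scaledLaguerre_coeff, Nat.choose_eq_zero_of_lt hk]
  simp

/-- The source of all orthogonality used here: the Pochhammer factor vanishes exactly when `β - α -
i` is one of `0, -1, …, -(m - 1)`. Besides `β = α` it is applied with `β = α + 2` and `β = α + 4`.
-/
theorem laguerreMoment_X_pow_mul_scaledLaguerre {α β : ℝ} (hα : -1 < α) (hβ : -1 < β) (m i : ℕ) :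
    laguerreMoment α (X ^ i * scaledLaguerre β m) =
      Real.Gamma (α + 1 + i) / Real.Gamma (β + 1 + m) *
        (ascPochhammer ℝ m).eval (β - α - i) := by
  have hi : (0 : ℝ) ≤ i := i.cast_nonneg
  have := sum_choose_Gamma_div_Gamma m (α + 1 + i) β (by linarith) (by linarith)
  rw [show β + 1 - (α + 1 + i) = β - α - i by ring] at this
  rw [← this, scaledLaguerre, Finset.mul_sum, map_sum]
  refine Finset.sum_congr rfl fun k _ => ?_
  rw [X_pow_mul_monomial, laguerreMoment_monomial]
  push_cast
  rw [show α + 1 + ((k : ℝ) + i) = α + 1 + i + k by ring]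
  ring

theorem ascPochhammer_eval_neg_natCast {j m : ℕ} (h : j < m) :
    (ascPochhammer ℝ m).eval (-(j : ℝ)) = 0 := by
  have := ascPochhammer_eval_neg_coe_nat_of_lt (R := ℝ) h
  exact this

theorem ascPochhammer_eval_one_eq_factorial (m : ℕ) : (ascPochhammer ℝ m).eval (1 : ℝ) = m.factorial := by
  simp

theorem ascPochhammer_eval_two (m : ℕ) :
    (ascPochhammer ℝ m).eval (2 : ℝ) = (m + 1).factorial := by
  induction m with
  | zero => simp
  | succ m ih =>
    rw [ascPochhammer_succ_eval, ih, Nat.factorial_succ (m + 1)]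
    push_cast
    ring

/-! ### Connection coefficients of the Laguerre-Sobolev polynomials -/

section coefficients

variable (α A B : ℝ) (n : ℕ)

/-- The mass at the origin, normalised. -/
def valueMass : ℝ :=
  A * n * Real.Gamma (α + n + 1) / (Real.Gamma (α + 1) * Real.Gamma (α + 2) * n.factorial)

/-- The mass of the first derivative at the origin, normalised. -/
def derivMass : ℝ :=
  B * (n * (n - 1)) * Real.Gamma (α + n + 1) /
    (Real.Gamma (α + 3) * Real.Gamma (α + 4) * n.factorial)

/-- Minus the determinant of the linear system formed by monicity and orthogonality to `1` and `X`;
Cramer's rule then gives the three quotients below. -/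
def connDen : ℝ :=
  1 + valueMass α A n + derivMass α B n *
    ((α + 2) * ((α + 2) * n - (α + 1)) + (n + α + 1) * valueMass α A n)

def connZero : ℝ := (1 - (α + 2) * (n + α + 1) * derivMass α B n) / connDen α A B n

def connOne : ℝ :=
  -(valueMass α A n + (α + 2) ^ 2 * n * derivMass α B n) / connDen α A B n

def connTwo : ℝ :=
  derivMass α B n * (n * (α + 2) + (n + α + 1) * valueMass α A n) / connDen α A B n

/-- The monic polynomial of degree `n` orthogonal for the Laguerre weight with point masses `A` on
values and `B` on first derivatives at the origin. -/
def laguerreSobolev : ℝ[X] :=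
  C ((-1) ^ n * Real.Gamma (α + n + 1)) *
    (C (connZero α A B n) * scaledLaguerre α n +
      C ((n + α + 1) * connOne α A B n) * (X * scaledLaguerre (α + 2) (n - 1)) +
      C ((n + α + 1) * (n + α + 2) * connTwo α A B n) * (X ^ 2 * scaledLaguerre (α + 4) (n - 2)))

end coefficients

variable {α β A B : ℝ}

theorem valueMass_nonneg (hα : -1 < α) (hA : 0 ≤ A) (n : ℕ) : 0 ≤ valueMass α A n := by
  have hn : (0 : ℝ) ≤ n := n.cast_nonneg
  have := Real.Gamma_pos_of_pos (by linarith : 0 < α + n + 1)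
  have := Real.Gamma_pos_of_pos (by linarith : 0 < α + 1)
  have := Real.Gamma_pos_of_pos (by linarith : 0 < α + 2)
  unfold valueMass
  positivity

theorem derivMass_nonneg (hα : -1 < α) (hB : 0 ≤ B) {n : ℕ} (hn : 1 ≤ n) :
    0 ≤ derivMass α B n := by
  have hn' : (1 : ℝ) ≤ n := by exact_mod_cast hn
  have := Real.Gamma_pos_of_pos (by linarith : 0 < α + n + 1)
  have := Real.Gamma_pos_of_pos (by linarith : 0 < α + 3)
  have := Real.Gamma_pos_of_pos (by linarith : 0 < α + 4)
  have : (0 : ℝ) ≤ n - 1 := by linarith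
  unfold derivMass
  positivity

theorem connDen_pos (hα : -1 < α) (hA : 0 ≤ A) (hB : 0 ≤ B) {n : ℕ} (hn : 1 ≤ n) :
    0 < connDen α A B n := by
  have hn' : (1 : ℝ) ≤ n := by exact_mod_cast hn
  have h1 := valueMass_nonneg hα hA n
  have h2 := derivMass_nonneg hα hB hn
  -- The right-hand side equals `(α + 2)(n - 1) + 1`.
  have h3 : 0 ≤ (α + 2) * n - (α + 1) := by nlinarith
  have h4 : 0 ≤ α + 2 := by linarith
  have h5 : 0 ≤ n + α + 1 := by linarith
  unfold connDen
  positivity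

/-- The monicity equation: the signs alternate because the leading coefficients of the Laguerre
factors of degrees `n`, `n - 1`, `n - 2` do. -/
theorem connZero_sub_connOne_add_connTwo (h : connDen α A B n ≠ 0) :
    connZero α A B n - connOne α A B n + connTwo α A B n = 1 := by
  rw [connZero, connOne, connTwo, ← sub_div, ← add_div, div_eq_one_iff_eq h, connDen]
  ring

theorem conn_orthogonal_one :
    connOne α A B n + (α + 2) * connTwo α A B n + valueMass α A n * connZero α A B n = 0 := by
  rw [connZero, connOne, connTwo, ← mul_div_assoc, ← mul_div_assoc, ← add_div, ← add_div,
    div_eq_zero_iff]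
  left
  ring

/-- Orthogonality to `X` after removing common factors: on the left the moment, to which only the
third term contributes, and on the right the derivative at `0`, to which only the first two do. -/
theorem conn_orthogonal_X :
    connTwo α A B n = derivMass α B n *
      (n * (α + 2) * connZero α A B n - (n + α + 1) * connOne α A B n) := by
  rw [connZero, connOne, connTwo, ← mul_div_assoc, ← mul_div_assoc, ← sub_div, ← mul_div_assoc]
  congr 1
  ring

theorem laguerreSobolev_natDegree_le {n : ℕ} (hn : 2 ≤ n) :
    (laguerreSobolev α A B n).natDegree ≤ n := by
  unfold laguerreSobolev
  refine (natDegree_C_mul_le _ _).trans (natDegree_add_le_of_degree_le (natDegree_add_le_of_degree_le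
    ((natDegree_C_mul_le _ _).trans (scaledLaguerre_natDegree_le _ _))
    ((natDegree_C_mul_le _ _).trans ?_)) ((natDegree_C_mul_le _ _).trans ?_))
  · refine natDegree_mul_le.trans ?_
    have := scaledLaguerre_natDegree_le (α + 2) (n - 1)
    rw [natDegree_X]
    omega
  · refine natDegree_mul_le.trans ?_
    have := scaledLaguerre_natDegree_le (α + 4) (n - 2)
    rw [natDegree_X_pow]
    omega

theorem laguerreSobolev_coeff_natCast (hα : -1 < α) (hA : 0 ≤ A) (hB : 0 ≤ B) {n : ℕ}
    (hn : 2 ≤ n) : (laguerreSobolev α A B n).coeff n = 1 := by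
  have h1 := connZero_sub_connOne_add_connTwo (connDen_pos hα hA hB (by omega : 1 ≤ n)).ne'
  obtain ⟨m, rfl⟩ := Nat.exists_eq_add_of_le' hn
  have hm : (0 : ℝ) ≤ m := m.cast_nonneg
  have hx : 0 < α + m + 3 := by linarith
  have hG := Real.Gamma_pos_of_pos hx
  have e1 : ∀ p : ℝ[X], (X * p).coeff (m + 2) = p.coeff (m + 1) := fun p => coeff_X_mul p (m + 1)
  have e2 : ∀ p : ℝ[X], (X ^ 2 * p).coeff (m + 2) = p.coeff m := fun p => coeff_X_pow_mul p 2 m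
  simp only [laguerreSobolev, coeff_C_mul, coeff_add, e1, e2, scaledLaguerre_coeff,
    Nat.add_sub_cancel, show m + 2 - 1 = m + 1 by omega, Nat.choose_self]
  push_cast
  rw [show α + (m + 2) + 1 = α + m + 3 by ring, show α + 1 + (m + 2) = α + m + 3 by ring,
    show α + 2 + 1 + (m + 1) = α + m + 3 + 1 by ring,
    show α + 4 + 1 + m = α + m + 3 + 1 + 1 by ring, Real.Gamma_add_one (by linarith : α + m + 3 + 1 ≠ 0),
    Real.Gamma_add_one hx.ne', show (m : ℝ) + 2 + α + 1 = α + m + 3 by ring,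
    show (m : ℝ) + 2 + α + 2 = α + m + 3 + 1 by ring]
  have : α + m + 3 + 1 ≠ 0 := by linarith
  have hs : ((-1 : ℝ) ^ m) ^ 2 = 1 := by rw [← pow_mul, mul_comm, pow_mul]; simp
  field_simp
  rw [pow_succ, pow_succ]
  linear_combination ((-1 : ℝ) ^ m) ^ 2 * h1 + hs

theorem laguerreSobolev_monic (hα : -1 < α) (hA : 0 ≤ A) (hB : 0 ≤ B) {n : ℕ}
    (hn : 2 ≤ n) : (laguerreSobolev α A B n).Monic :=
  monic_of_natDegree_le_of_coeff_eq_one n (laguerreSobolev_natDegree_le hn)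
    (laguerreSobolev_coeff_natCast hα hA hB hn)

theorem laguerreSobolev_natDegree (hα : -1 < α) (hA : 0 ≤ A) (hB : 0 ≤ B) {n : ℕ}
    (hn : 2 ≤ n) : (laguerreSobolev α A B n).natDegree = n :=
  natDegree_eq_of_le_of_coeff_ne_zero (laguerreSobolev_natDegree_le hn)
    (by rw [laguerreSobolev_coeff_natCast hα hA hB hn]; exact one_ne_zero)

theorem laguerreMoment_laguerreSobolev_mul (hα : -1 < α) {n : ℕ} (j : ℕ) :
    laguerreMoment α (laguerreSobolev α A B n * X ^ j) =
      (-1) ^ n * Real.Gamma (α + n + 1) *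
      (connZero α A B n * (Real.Gamma (α + 1 + j) / Real.Gamma (α + 1 + n) *
          (ascPochhammer ℝ n).eval (-(j : ℝ))) +
        (n + α + 1) * connOne α A B n * (Real.Gamma (α + 2 + j) /
          Real.Gamma (α + 3 + (n - 1 : ℕ)) * (ascPochhammer ℝ (n - 1)).eval (1 - (j : ℝ))) +
        (n + α + 1) * (n + α + 2) * connTwo α A B n * (Real.Gamma (α + 3 + j) /
          Real.Gamma (α + 5 + (n - 2 : ℕ)) * (ascPochhammer ℝ (n - 2)).eval (2 - (j : ℝ)))) := by
  have e : laguerreSobolev α A B n * X ^ j = ((-1) ^ n * Real.Gamma (α + n + 1)) •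
      (connZero α A B n • (X ^ j * scaledLaguerre α n) +
      ((n + α + 1) * connOne α A B n) • (X ^ (j + 1) * scaledLaguerre (α + 2) (n - 1)) +
      ((n + α + 1) * (n + α + 2) * connTwo α A B n) •
        (X ^ (j + 2) * scaledLaguerre (α + 4) (n - 2))) := by
    simp only [laguerreSobolev, smul_eq_C_mul]
    ring
  rw [e]
  simp only [map_smul, map_add, smul_eq_mul]
  rw [laguerreMoment_X_pow_mul_scaledLaguerre hα hα,
    laguerreMoment_X_pow_mul_scaledLaguerre hα (by linarith),
    laguerreMoment_X_pow_mul_scaledLaguerre hα (by linarith)]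
  push_cast
  ring_nf

theorem laguerreSobolev_coeff_zero (α A B : ℝ) (n : ℕ) : (laguerreSobolev α A B n).coeff 0 =
    (-1) ^ n * Real.Gamma (α + n + 1) * (connZero α A B n / Real.Gamma (α + 1)) := by
  have e2 : ∀ p : ℝ[X], (X ^ 2 * p).coeff 0 = 0 := fun p => by simp [mul_coeff_zero]
  simp only [laguerreSobolev, scaledLaguerre_coeff, coeff_C_mul, coeff_add, e2]
  simp [div_eq_mul_inv]

theorem laguerreSobolev_coeff_one (α A B : ℝ) (n : ℕ) : (laguerreSobolev α A B n).coeff 1 =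
    (-1) ^ n * Real.Gamma (α + n + 1) * (-(n * connZero α A B n / Real.Gamma (α + 2)) +
      (n + α + 1) * connOne α A B n / Real.Gamma (α + 3)) := by
  have e1 : ∀ p : ℝ[X], (X * p).coeff 1 = p.coeff 0 := fun p => coeff_X_mul p 0
  have e2 : ∀ p : ℝ[X], (X ^ 2 * p).coeff 1 = 0 := fun p => by
    rw [pow_two, mul_assoc, e1]; simp
  simp only [laguerreSobolev, scaledLaguerre_coeff, coeff_C_mul, coeff_add, e1, e2]
  simp
  left
  rw [show α + 1 + 1 = α + 2 by ring, show α + 2 + 1 = α + 3 by ring]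
  ring

/-- Orthogonality of `laguerreSobolev` to all monomials of lower degree. -/
theorem laguerreSobolev_orthogonal (hα : -1 < α) {n j : ℕ} (hn : 2 ≤ n) (hj : j < n) :
    laguerreMoment α (laguerreSobolev α A B n * X ^ j) +
      A * (laguerreSobolev α A B n).coeff 0 * (X ^ j : ℝ[X]).coeff 0 +
      B * (laguerreSobolev α A B n).coeff 1 * (X ^ j : ℝ[X]).coeff 1 = 0 := by
  have h1 := conn_orthogonal_one (α := α) (A := A) (B := B) (n := n)
  have h2 := conn_orthogonal_X (α := α) (A := A) (B := B) (n := n)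
  obtain ⟨m, rfl⟩ := Nat.exists_eq_add_of_le' hn
  have hm : (0 : ℝ) ≤ m := m.cast_nonneg
  have hx : 0 < α + m + 3 := by linarith
  have hG := (Real.Gamma_pos_of_pos hx).ne'
  have h41 : α + m + 3 + 1 ≠ 0 := by linarith
  have hG1 := (Real.Gamma_pos_of_pos (by linarith : 0 < α + 1)).ne'
  have hG2 := (Real.Gamma_pos_of_pos (by linarith : 0 < α + 2)).ne'
  have hG3 := (Real.Gamma_pos_of_pos (by linarith : 0 < α + 3)).ne'
  have hG4 := (Real.Gamma_pos_of_pos (by linarith : 0 < α + 4)).ne'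
  have r3 : Real.Gamma (α + 3) = (α + 2) * Real.Gamma (α + 2) := by
    rw [← Real.Gamma_add_one (by linarith)]; ring_nf
  have hf : (m.factorial : ℝ) ≠ 0 := by exact_mod_cast m.factorial_ne_zero
  rw [laguerreMoment_laguerreSobolev_mul hα, ascPochhammer_eval_neg_natCast hj]
  simp only [Nat.add_sub_cancel, show m + 2 - 1 = m + 1 by omega]
  rw [laguerreSobolev_coeff_zero, laguerreSobolev_coeff_one]
  have g1 : α + ((m + 2 : ℕ) : ℝ) + 1 = α + m + 3 := by push_cast; ring
  have g2 : α + 3 + ((m + 1 : ℕ) : ℝ) = α + m + 3 + 1 := by push_cast; ring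
  have g3 : α + 5 + (m : ℝ) = α + m + 3 + 1 + 1 := by ring
  have g4 : ((m + 2 : ℕ) : ℝ) + α + 1 = α + m + 3 := by push_cast; ring
  have g5 : ((m + 2 : ℕ) : ℝ) + α + 2 = α + m + 3 + 1 := by push_cast; ring
  have hmf : ((m + 2).factorial : ℝ) = (m + 2) * ((m + 1) * m.factorial) := by
    rw [Nat.factorial_succ, Nat.factorial_succ]; push_cast; ring
  have hmf' : ((m + 1).factorial : ℝ) = (m + 1) * m.factorial := by
    rw [Nat.factorial_succ]; push_cast; ring
  rw [g1, g2, g3, g4, g5, Real.Gamma_add_one h41, Real.Gamma_add_one hx.ne']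
  rw [valueMass, g1, hmf] at h1
  rw [derivMass, g1, g4, hmf] at h2
  push_cast at h1 h2 ⊢
  generalize connZero α A B (m + 2) = a at *
  generalize connOne α A B (m + 2) = b at *
  generalize connTwo α A B (m + 2) = c at *
  have hm1 : (m : ℝ) + 1 ≠ 0 := by positivity
  have hm2 : (m : ℝ) + 2 ≠ 0 := by positivity
  -- The `L_n^α` term is already gone. For `j = 0` the other two moments survive, for `j = 1` only
  -- the last, and for larger `j` none; the two low cases are the equations `h1` and `h2`.
  match j, hj with
  | 0, _ =>
    have p1 : (ascPochhammer ℝ (m + 1)).eval (1 - ((0 : ℕ) : ℝ)) = (m + 1).factorial := by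
      rw [← ascPochhammer_eval_one_eq_factorial]; simp
    have p2 : (ascPochhammer ℝ m).eval (2 - ((0 : ℕ) : ℝ)) = (m + 1).factorial := by
      rw [← ascPochhammer_eval_two]; simp
    rw [p1, p2, hmf']
    simp only [pow_zero, coeff_one, one_ne_zero, if_false, if_true, Nat.cast_zero, add_zero]
    rw [r3]
    field_simp at h1 ⊢
    linear_combination (-1) ^ m * Real.Gamma (α + 2) * h1
  | 1, _ =>
    have p1 : (ascPochhammer ℝ (m + 1)).eval (1 - ((1 : ℕ) : ℝ)) = 0 := by
      rw [← ascPochhammer_eval_neg_natCast (Nat.succ_pos m)]; simp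
    have p2 : (ascPochhammer ℝ m).eval (2 - ((1 : ℕ) : ℝ)) = m.factorial := by
      rw [← ascPochhammer_eval_one_eq_factorial]; norm_num
    rw [p1, p2]
    simp only [pow_one, coeff_X_zero, coeff_X_one, Nat.cast_one]
    rw [show α + 3 + 1 = α + 4 by ring, r3]
    rw [r3, show (m : ℝ) + 2 - 1 = m + 1 by ring] at h2
    have : α + 2 ≠ 0 := by linarith
    field_simp at h2 ⊢
    linear_combination (-1) ^ m * Real.Gamma (α + 1) * h2
  | j + 2, hj =>
    have p1 : (ascPochhammer ℝ (m + 1)).eval (1 - ((j + 2 : ℕ) : ℝ)) = 0 := by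
      rw [← ascPochhammer_eval_neg_natCast (show j + 1 < m + 1 by omega)]
      congr 1; push_cast; ring
    have p2 : (ascPochhammer ℝ m).eval (2 - ((j + 2 : ℕ) : ℝ)) = 0 := by
      rw [← ascPochhammer_eval_neg_natCast (show j < m by omega)]
      congr 1; push_cast; ring
    rw [p1, p2]
    simp [coeff_X_pow]

/-! ### Hermite moments and the substitution `t = x²` -/

open MeasureTheory

theorem integrable_pow_mul_exp_neg_sq (k : ℕ) :
    Integrable fun x : ℝ => x ^ k * Real.exp (-x ^ 2) := by
  have := integrable_rpow_mul_exp_neg_mul_sq (b := 1) one_pos (s := k)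
    (by have : (0 : ℝ) ≤ k := k.cast_nonneg
        linarith)
  simpa using this

theorem integrable_eval_mul_exp_neg_sq (P : ℝ[X]) :
    Integrable fun x : ℝ => P.eval x * Real.exp (-x ^ 2) := by
  induction P using Polynomial.induction_on' with
  | add p q hp hq => simpa only [eval_add, add_mul] using! hp.add hq
  | monomial k c =>
    simpa [mul_assoc] using (integrable_pow_mul_exp_neg_sq k).const_mul c

/-- Integration against the weight `exp (-x ^ 2)`. -/
def hermiteMoment : ℝ[X] →ₗ[ℝ] ℝ where
  toFun P := ∫ x : ℝ, P.eval x * Real.exp (-x ^ 2)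
  map_add' P Q := by
    simp only [eval_add, add_mul]
    exact integral_add (integrable_eval_mul_exp_neg_sq P) (integrable_eval_mul_exp_neg_sq Q)
  map_smul' c P := by
    simp only [eval_smul, smul_eq_mul, mul_assoc, integral_const_mul, RingHom.id_apply]

theorem hermiteMoment_apply (P : ℝ[X]) :
    hermiteMoment P = ∫ x : ℝ, P.eval x * Real.exp (-x ^ 2) := rfl

theorem integral_pow_even_mul_exp_neg_sq (k : ℕ) :
    ∫ x : ℝ, x ^ (2 * k) * Real.exp (-x ^ 2) = Real.Gamma (k + 1 / 2) := by
  have h := integral_comp_abs (f := fun x : ℝ => x ^ (2 * k) * Real.exp (-x ^ 2))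
  have e : ∀ x : ℝ, |x| ^ (2 * k) * Real.exp (-|x| ^ 2) = x ^ (2 * k) * Real.exp (-x ^ 2) :=
    fun x => by rw [pow_mul, pow_mul, sq_abs]
  simp only [e] at h
  have h2 := integral_rpow_mul_exp_neg_rpow (p := 2) (q := ((2 * k : ℕ) : ℝ)) two_pos
    (by have : (0 : ℝ) ≤ ((2 * k : ℕ) : ℝ) := Nat.cast_nonneg _
        linarith)
  simp only [Real.rpow_natCast, Real.rpow_two] at h2
  rw [h, h2, show ((2 * k : ℕ) + 1 : ℝ) / 2 = k + 1 / 2 by push_cast; ring]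
  ring

theorem integral_pow_odd_mul_exp_neg_sq (k : ℕ) :
    ∫ x : ℝ, x ^ (2 * k + 1) * Real.exp (-x ^ 2) = 0 := by
  have h := integral_neg_eq_self (fun x : ℝ => x ^ (2 * k + 1) * Real.exp (-x ^ 2)) volume
  simp only [Odd.neg_pow ⟨k, rfl⟩, neg_sq, neg_mul, integral_neg] at h
  linarith

theorem hermiteMoment_monomial_even (k : ℕ) (c : ℝ) :
    hermiteMoment (monomial (2 * k) c) = c * Real.Gamma (k + 1 / 2) := by
  simp only [hermiteMoment_apply, eval_monomial, mul_assoc, integral_const_mul,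
    integral_pow_even_mul_exp_neg_sq]

theorem hermiteMoment_monomial_odd (k : ℕ) (c : ℝ) :
    hermiteMoment (monomial (2 * k + 1) c) = 0 := by
  simp only [hermiteMoment_apply, eval_monomial, mul_assoc, integral_const_mul,
    integral_pow_odd_mul_exp_neg_sq, mul_zero]

/-- The moments agree: the integral of `x^(2k)` is `Γ(k + 1/2)`. An extra factor `x²` shifts this to
`Γ(k + 3/2)`, hence the exponent `1/2` in the odd case. -/
theorem hermiteMoment_expand (P : ℝ[X]) :
    hermiteMoment (expand ℝ 2 P) = laguerreMoment (-1 / 2) P := by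
  induction P using Polynomial.induction_on' with
  | add p q hp hq => simp [hp, hq]
  | monomial k c =>
    rw [expand_monomial, mul_comm k, hermiteMoment_monomial_even, laguerreMoment_monomial]
    ring_nf

theorem hermiteMoment_X_mul_expand (P : ℝ[X]) : hermiteMoment (X * expand ℝ 2 P) = 0 := by
  induction P using Polynomial.induction_on' with
  | add p q hp hq => simp [mul_add, hp, hq]
  | monomial k c =>
    rw [expand_monomial, mul_comm k, X_mul_monomial, hermiteMoment_monomial_odd]

theorem hermiteMoment_X_sq_mul_expand (P : ℝ[X]) :
    hermiteMoment (X ^ 2 * expand ℝ 2 P) = laguerreMoment (1 / 2) P := by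
  induction P using Polynomial.induction_on' with
  | add p q hp hq => simp [mul_add, hp, hq]
  | monomial k c =>
    rw [expand_monomial, mul_comm k, X_pow_mul_monomial, show 2 * k + 2 = 2 * (k + 1) by ring,
      hermiteMoment_monomial_even, laguerreMoment_monomial]
    push_cast
    ring_nf

theorem eval_zero_iterate_derivative (P : ℝ[X]) (i : ℕ) :
    (derivative^[i] P).eval 0 = i.factorial * P.coeff i := by
  rw [← coeff_zero_eq_eval_zero, coeff_iterate_derivative]
  simp [Nat.descFactorial_self]

theorem sobolevInner_eq (M : Fin 4 → ℝ) (P Q : ℝ[X]) :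
    sobolevInner M P Q = hermiteMoment (P * Q) +
      ∑ i : Fin 4, M i * ((i : ℕ).factorial : ℝ) ^ 2 * P.coeff i * Q.coeff i := by
  rw [sobolevInner, hermiteMoment_apply]
  simp only [eval_mul, eval_zero_iterate_derivative]
  congr 1
  refine Finset.sum_congr rfl fun i _ => ?_
  ring

/-! ### The Sobolev inner product: uniqueness and reduction by parity -/

variable {M : Fin 4 → ℝ}

theorem sobolevInner_comm (P Q : ℝ[X]) : sobolevInner M P Q = sobolevInner M Q P := by
  rw [sobolevInner_eq, sobolevInner_eq, mul_comm]
  congr 1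
  refine Finset.sum_congr rfl fun i _ => ?_
  ring

theorem sobolevInner_add (P Q R : ℝ[X]) :
    sobolevInner M P (Q + R) = sobolevInner M P Q + sobolevInner M P R := by
  simp only [sobolevInner_eq, mul_add, map_add, coeff_add, Finset.sum_add_distrib]
  ring

theorem sobolevInner_smul (P Q : ℝ[X]) (c : ℝ) :
    sobolevInner M P (c • Q) = c * sobolevInner M P Q := by
  simp only [sobolevInner_eq, mul_smul_comm, map_smul, coeff_smul, smul_eq_mul, mul_add,
    Finset.mul_sum]
  congr 1
  refine Finset.sum_congr rfl fun i _ => ?_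
  ring

theorem sobolevInner_sub (P Q R : ℝ[X]) :
    sobolevInner M P (Q - R) = sobolevInner M P Q - sobolevInner M P R := by
  have h := sobolevInner_add (M := M) P Q ((-1 : ℝ) • R)
  rw [sobolevInner_smul, neg_one_smul, ← sub_eq_add_neg] at h
  rw [h]
  ring

/-- The mass terms are nonnegative, so the integral of `P² e^{-x²}` vanishes; by continuity the
integrand is zero everywhere. -/
theorem sobolevInner_definite (hM : ∀ i, 0 ≤ M i) {P : ℝ[X]} (h : sobolevInner M P P = 0) :
    P = 0 := by
  rw [sobolevInner_eq, hermiteMoment_apply] at h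
  have h1 : 0 ≤ ∑ i : Fin 4, M i * ((i : ℕ).factorial : ℝ) ^ 2 * P.coeff i * P.coeff i := by
    refine Finset.sum_nonneg fun i _ => ?_
    rw [mul_assoc]
    exact mul_nonneg (mul_nonneg (hM i) (sq_nonneg _)) (mul_self_nonneg _)
  have hpos : 0 ≤ fun x : ℝ => (P * P).eval x * Real.exp (-x ^ 2) := fun x => by
    simp only [eval_mul, Pi.zero_apply]
    exact mul_nonneg (mul_self_nonneg _) (Real.exp_pos _).le
  have h2 : 0 ≤ ∫ x : ℝ, (P * P).eval x * Real.exp (-x ^ 2) := integral_nonneg hpos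
  have h3 : ∫ x : ℝ, (P * P).eval x * Real.exp (-x ^ 2) = 0 := by linarith
  rw [integral_eq_zero_iff_of_nonneg hpos (integrable_eval_mul_exp_neg_sq _)] at h3
  have hc : Continuous fun x : ℝ => (P * P).eval x * Real.exp (-x ^ 2) :=
    (P * P).continuous.mul (by fun_prop)
  have h4 := (hc.ae_eq_iff_eq volume continuous_const).mp h3
  refine Polynomial.funext fun x => ?_
  have : (P * P).eval x * Real.exp (-x ^ 2) = 0 := congrFun h4 x
  simpa [Real.exp_ne_zero] using this

theorem sobolevInner_eq_zero_of_forall_X_pow {P : ℝ[X]} {N : ℕ}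
    (h : ∀ j < N, sobolevInner M P (X ^ j) = 0) {Q : ℝ[X]} (hQ : Q.degree < N) :
    sobolevInner M P Q = 0 := by
  let L : ℝ[X] →ₗ[ℝ] ℝ :=
    { toFun := sobolevInner M P
      map_add' := sobolevInner_add P
      map_smul' := fun c Q => sobolevInner_smul P Q c }
  have hL : ∀ Q, sobolevInner M P Q = L Q := fun _ => rfl
  rw [hL, Q.as_sum_support, map_sum]
  refine Finset.sum_eq_zero fun j hj => ?_
  rw [← C_mul_X_pow_eq_monomial, ← smul_eq_C_mul, map_smul, ← hL, h j
    (by exact_mod_cast (le_degree_of_mem_supp j hj).trans_lt hQ), smul_zero]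

/-- Leading terms are peeled off with multiples of `S d`. The bound `d` is kept apart from `N` so
that the induction runs with `N` fixed. -/
theorem IsMonicOrthogonalSequence.sobolevInner_eq_zero {S : ℕ → ℝ[X]}
    (hS : IsMonicOrthogonalSequence M S) {N d : ℕ} (hd : d ≤ N) {Q : ℝ[X]} (hQ : Q.degree < d) :
    sobolevInner M (S N) Q = 0 := by
  induction d generalizing Q with
  | zero =>
    have : Q = 0 := by simpa [Nat.WithBot.lt_zero_iff] using hQ
    rw [this, sobolevInner_eq]
    simp
  | succ d ih =>
    have hR : (Q - Q.coeff d • S d).degree < d := by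
      rw [degree_lt_iff_coeff_zero]
      intro k hk
      rcases hk.eq_or_lt with rfl | hk
      · have := (hS.monic d).coeff_natDegree
        rw [hS.natDegree_eq] at this
        simp [this]
      · have h1 : Q.coeff k = 0 := coeff_eq_zero_of_degree_lt
          (hQ.trans_le (by exact_mod_cast hk))
        have h2 : (S d).coeff k = 0 := coeff_eq_zero_of_natDegree_lt (by rwa [hS.natDegree_eq])
        simp [h1, h2]
    have := ih (by omega) hR
    rwa [sobolevInner_sub, sobolevInner_smul, hS.orthogonal N d (by omega), mul_zero,
      sub_zero] at this

/-- Uniqueness of the monic orthogonal polynomials. -/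
theorem IsMonicOrthogonalSequence.eq_of_forall_X_pow (hM : ∀ i, 0 ≤ M i) {S : ℕ → ℝ[X]}
    (hS : IsMonicOrthogonalSequence M S) {N : ℕ} {R : ℝ[X]} (hR : R.Monic)
    (hdeg : R.natDegree = N) (h : ∀ j < N, sobolevInner M R (X ^ j) = 0) : S N = R := by
  have hd : (S N - R).degree < N := by
    have h1 : (S N).degree = N := by
      rw [degree_eq_natDegree (hS.monic N).ne_zero, hS.natDegree_eq]
    have h2 : R.degree = N := by rw [degree_eq_natDegree hR.ne_zero, hdeg]
    rw [← h1]
    exact degree_sub_lt_left (h1.trans h2.symm) (hS.monic N).ne_zero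
      ((hS.monic N).leadingCoeff.trans hR.leadingCoeff.symm)
  -- The difference has degree below `N`, so it is orthogonal to both polynomials and hence to
  -- itself.
  refine sub_eq_zero.mp (sobolevInner_definite hM ?_)
  rw [sobolevInner_sub, sobolevInner_comm, hS.sobolevInner_eq_zero le_rfl hd,
    sobolevInner_comm, sobolevInner_eq_zero_of_forall_X_pow h hd, sub_zero]

/-- The second derivative of `P(x²)` at `0` is `2 P'(0)`, whence the mass `4 * M 2`. Odd test
monomials contribute nothing. -/
theorem IsMonicOrthogonalSequence.even_eq (hM : ∀ i, 0 ≤ M i) {S : ℕ → ℝ[X]}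
    (hS : IsMonicOrthogonalSequence M S) {n : ℕ} (hn : 2 ≤ n) :
    S (2 * n) = expand ℝ 2 (laguerreSobolev (-1 / 2) (M 0) (4 * M 2) n) := by
  have hα : (-1 : ℝ) < -1 / 2 := by norm_num
  have hB : 0 ≤ 4 * M 2 := mul_nonneg (by norm_num) (hM 2)
  refine hS.eq_of_forall_X_pow hM
    ((laguerreSobolev_monic hα (hM 0) hB hn).expand two_pos) ?_ fun j hj => ?_
  · rw [natDegree_expand, laguerreSobolev_natDegree hα (hM 0) hB hn, mul_comm]
  · have ho := fun i => laguerreSobolev_orthogonal (A := M 0) (B := 4 * M 2) hα hn (j := i)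
    set P := laguerreSobolev (-1 / 2) (M 0) (4 * M 2) n
    have c1 : (expand ℝ 2 P).coeff 1 = 0 := by rw [coeff_expand two_pos]; simp
    have c3 : (expand ℝ 2 P).coeff 3 = 0 := by rw [coeff_expand two_pos]; simp
    have c0 : (expand ℝ 2 P).coeff 0 = P.coeff 0 := by rw [coeff_expand two_pos]; simp
    have c2 : (expand ℝ 2 P).coeff 2 = P.coeff 1 := by rw [coeff_expand two_pos]; simp
    rw [sobolevInner_eq]
    simp only [Fin.sum_univ_four, Fin.val_zero, Fin.val_one, Fin.val_two,
      show ((3 : Fin 4) : ℕ) = 3 from rfl, c0, c1, c2, c3]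
    rcases Nat.even_or_odd' j with ⟨i, rfl | rfl⟩
    · rw [pow_mul, ← expand_X (R := ℝ), ← map_pow, ← map_mul, hermiteMoment_expand]
      have e0 : (expand ℝ 2 (X ^ i : ℝ[X])).coeff 0 = (X ^ i : ℝ[X]).coeff 0 := by
        rw [coeff_expand two_pos]; simp
      have e2 : (expand ℝ 2 (X ^ i : ℝ[X])).coeff 2 = (X ^ i : ℝ[X]).coeff 1 := by
        rw [coeff_expand two_pos]; simp
      rw [e0, e2]
      simp only [Nat.factorial]
      push_cast
      linear_combination ho i (by omega)
    · have e : expand ℝ 2 P * X ^ (2 * i + 1) = X * expand ℝ 2 (P * X ^ i) := by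
        rw [map_mul, map_pow, expand_X]; ring
      rw [e, hermiteMoment_X_mul_expand]
      have d0 : (X ^ (2 * i + 1) : ℝ[X]).coeff 0 = 0 := by rw [coeff_X_pow, if_neg (by omega)]
      have d2 : (X ^ (2 * i + 1) : ℝ[X]).coeff 2 = 0 := by rw [coeff_X_pow, if_neg (by omega)]
      rw [d0, d2]
      ring

/-- For `x P(x²)` the first derivative at `0` is `P(0)` and the third is `6 P'(0)`, whence the mass
`36 * M 3`. -/
theorem IsMonicOrthogonalSequence.odd_eq (hM : ∀ i, 0 ≤ M i) {S : ℕ → ℝ[X]}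
    (hS : IsMonicOrthogonalSequence M S) {n : ℕ} (hn : 2 ≤ n) :
    S (2 * n + 1) = X * expand ℝ 2 (laguerreSobolev (1 / 2) (M 1) (36 * M 3) n) := by
  have hα : (-1 : ℝ) < 1 / 2 := by norm_num
  have hB : 0 ≤ 36 * M 3 := mul_nonneg (by norm_num) (hM 3)
  have hmon := (laguerreSobolev_monic hα (hM 1) hB hn).expand two_pos
  refine hS.eq_of_forall_X_pow hM (monic_X.mul hmon) ?_ fun j hj => ?_
  · rw [monic_X.natDegree_mul hmon, natDegree_X, natDegree_expand,
      laguerreSobolev_natDegree hα (hM 1) hB hn]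
    omega
  · have ho := fun i => laguerreSobolev_orthogonal (A := M 1) (B := 36 * M 3) hα hn (j := i)
    set P := laguerreSobolev (1 / 2) (M 1) (36 * M 3) n
    have ex : ∀ (p : ℝ[X]) (k : ℕ), (X * p).coeff (k + 1) = p.coeff k := coeff_X_mul
    have c0 : (X * expand ℝ 2 P).coeff 0 = 0 := by simp
    have c1 : (X * expand ℝ 2 P).coeff 1 = P.coeff 0 := by
      rw [ex _ 0, coeff_expand two_pos]; simp
    have c2 : (X * expand ℝ 2 P).coeff 2 = 0 := by rw [ex _ 1, coeff_expand two_pos]; simp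
    have c3 : (X * expand ℝ 2 P).coeff 3 = P.coeff 1 := by
      rw [ex _ 2, coeff_expand two_pos]; simp
    rw [sobolevInner_eq]
    simp only [Fin.sum_univ_four, Fin.val_zero, Fin.val_one, Fin.val_two,
      show ((3 : Fin 4) : ℕ) = 3 from rfl, c0, c1, c2, c3]
    rcases Nat.even_or_odd' j with ⟨i, rfl | rfl⟩
    · have e : X * expand ℝ 2 P * X ^ (2 * i) = X * expand ℝ 2 (P * X ^ i) := by
        rw [map_mul, map_pow, expand_X]; ring
      rw [e, hermiteMoment_X_mul_expand]
      have d1 : (X ^ (2 * i) : ℝ[X]).coeff 1 = 0 := by rw [coeff_X_pow, if_neg (by omega)]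
      have d3 : (X ^ (2 * i) : ℝ[X]).coeff 3 = 0 := by rw [coeff_X_pow, if_neg (by omega)]
      rw [d1, d3]
      ring
    · have e : X * expand ℝ 2 P * X ^ (2 * i + 1) = X ^ 2 * expand ℝ 2 (P * X ^ i) := by
        rw [map_mul, map_pow, expand_X]; ring
      rw [e, hermiteMoment_X_sq_mul_expand]
      have d1 : (X ^ (2 * i + 1) : ℝ[X]).coeff 1 = (X ^ i : ℝ[X]).coeff 0 := by
        simp only [coeff_X_pow]; congr 1; simp; omega
      have d3 : (X ^ (2 * i + 1) : ℝ[X]).coeff 3 = (X ^ i : ℝ[X]).coeff 1 := by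
        simp only [coeff_X_pow]; congr 1; simp; omega
      rw [d1, d3]
      simp only [Nat.factorial]
      push_cast
      linear_combination ho i (by omega)

/-! ### Mehler-Heine limit for Laguerre polynomials -/

/-- Power series coefficients of `t ↦ t ^ (-β / 2) * J_β (2 √t)`. -/
def besselCoeff (β : ℝ) (k : ℕ) : ℝ := (-1) ^ k / (k.factorial * Real.Gamma (β + 1 + k))

/-- The entire function `t ↦ t ^ (-β / 2) * J_β (2 √t)`. -/
def besselEntire (β : ℝ) (t : ℂ) : ℂ := ∑' k : ℕ, (besselCoeff β k : ℂ) * t ^ k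

theorem summable_abs_besselCoeff_mul_pow (hβ : -1 < β) {R : ℝ} (hR : 0 < R) :
    Summable fun k => |besselCoeff β k| * R ^ k := by
  have hne : ∀ k : ℕ, 0 < |besselCoeff β k| * R ^ k := fun k => by
    have hk : (0 : ℝ) ≤ k := k.cast_nonneg
    have := (Real.Gamma_pos_of_pos (by linarith : 0 < β + 1 + k)).ne'
    have hb : besselCoeff β k ≠ 0 := by unfold besselCoeff; positivity
    positivity
  refine summable_of_ratio_test_tendsto_lt_one (l := 0) one_pos
    (Eventually.of_forall fun k => (hne k).ne') ?_
  have e : ∀ k : ℕ, ‖|besselCoeff β (k + 1)| * R ^ (k + 1)‖ / ‖|besselCoeff β k| * R ^ k‖ =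
      R * ((1 / ((k : ℝ) + 1)) * (1 / (β + 1 + k))) := fun k => by
    have hk : (0 : ℝ) ≤ k := k.cast_nonneg
    have hp : 0 < β + 1 + k := by linarith
    have hG := Real.Gamma_pos_of_pos hp
    rw [Real.norm_of_nonneg (hne _).le, Real.norm_of_nonneg (hne _).le]
    simp only [besselCoeff, abs_div, abs_pow, abs_neg, abs_one, one_pow, abs_mul]
    rw [Nat.factorial_succ]
    push_cast
    rw [← add_assoc, Real.Gamma_add_one hp.ne', abs_of_pos hG, abs_of_pos (mul_pos hp hG),
      abs_of_pos (by positivity : (0 : ℝ) < k.factorial),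
      abs_of_pos (by positivity : (0 : ℝ) < (k + 1) * k.factorial)]
    field_simp
    ring
  simp only [e]
  have h2 : Tendsto (fun k : ℕ => 1 / (β + 1 + (k : ℝ))) atTop (𝓝 0) := by
    simp only [one_div]
    exact tendsto_inv_atTop_zero.comp (tendsto_atTop_add_const_left _ _ tendsto_natCast_atTop_atTop)
  simpa using ((tendsto_one_div_add_atTop_nhds_zero_nat (𝕜 := ℝ)).mul h2).const_mul R

theorem tendsto_natCast_sub_div (j : ℕ) :
    Tendsto (fun n : ℕ => ((n - j : ℕ) : ℝ) / n) atTop (𝓝 1) := by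
  have h : Tendsto (fun n : ℕ => 1 - (j : ℝ) / n) atTop (𝓝 (1 - 0)) :=
    tendsto_const_nhds.sub (tendsto_const_div_atTop_nhds_zero_nat _)
  rw [sub_zero] at h
  refine h.congr' ?_
  filter_upwards [eventually_ge_atTop (j + 1)] with n hn
  have : (n : ℝ) ≠ 0 := by
    have : n ≠ 0 := by omega
    exact_mod_cast this
  rw [Nat.cast_sub (by omega)]
  field_simp

theorem tendsto_descFactorial_sub_div_pow (j k : ℕ) :
    Tendsto (fun n : ℕ => ((n - j).descFactorial k : ℝ) / n ^ k) atTop (𝓝 1) := by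
  induction k with
  | zero => simp
  | succ k ih =>
    have := (tendsto_natCast_sub_div (j + k)).mul ih
    rw [one_mul] at this
    refine this.congr fun n => ?_
    rw [Nat.descFactorial_succ, Nat.sub_sub, pow_succ', Nat.cast_mul, div_mul_div_comm]

theorem descFactorial_sub_div_pow_le_one (j k n : ℕ) :
    ((n - j).descFactorial k : ℝ) / n ^ k ≤ 1 := by
  refine div_le_one_of_le₀ ?_ (by positivity)
  exact_mod_cast (Nat.descFactorial_le_pow _ _).trans (Nat.pow_le_pow_left (n.sub_le j) k)

/-- The falling factorial vanishes beyond `m`, so a finite sum can be written as the Bessel series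
with damping factors. For `m = n - j` these lie in `[0, 1]` and tend to `1`. -/
theorem aeval_scaledLaguerre (β : ℝ) (m n : ℕ) (t : ℂ) :
    aeval (t / n) (scaledLaguerre β m) =
      ∑' k : ℕ, ((besselCoeff β k * ((m.descFactorial k : ℝ) / n ^ k) : ℝ) : ℂ) * t ^ k := by
  rw [tsum_eq_sum (s := Finset.range (m + 1)), scaledLaguerre, map_sum]
  · refine Finset.sum_congr rfl fun k _ => ?_
    rw [aeval_monomial, Nat.descFactorial_eq_factorial_mul_choose, besselCoeff]
    have : (k.factorial : ℝ) ≠ 0 := by exact_mod_cast k.factorial_ne_zero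
    have e : (-1) ^ k / (k.factorial * Real.Gamma (β + 1 + k)) *
        (((k.factorial * m.choose k : ℕ) : ℝ) / n ^ k) =
        (-1) ^ k * (m.choose k : ℝ) / Real.Gamma (β + 1 + k) * (1 / n ^ k) := by
      push_cast
      field_simp
    rw [e, Complex.coe_algebraMap, div_pow]
    push_cast
    ring
  · intro k hk
    rw [Finset.mem_range, not_lt] at hk
    rw [Nat.descFactorial_eq_zero_iff_lt.mpr (by omega)]
    simp

/-- The Mehler-Heine asymptotics of Laguerre polynomials. -/
theorem tendstoLocallyUniformly_scaledLaguerre (hβ : -1 < β) (j : ℕ) :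
    TendstoLocallyUniformly (fun (n : ℕ) (t : ℂ) => aeval (t / n) (scaledLaguerre β (n - j)))
      (besselEntire β) atTop := by
  rw [tendstoLocallyUniformly_iff_forall_isCompact]
  intro K hK
  obtain ⟨R, hR0, hR⟩ := hK.isBounded.exists_pos_norm_le
  have hs := summable_abs_besselCoeff_mul_pow hβ hR0
  set ρ : ℕ → ℕ → ℝ := fun n k => ((n - j).descFactorial k : ℝ) / n ^ k with hρ
  have hρ0 : ∀ n k, 0 ≤ ρ n k := fun n k => by positivity
  have hρ1 : ∀ n k, ρ n k ≤ 1 := fun n k => descFactorial_sub_div_pow_le_one j k n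
  -- This series bounds the error at every `t` with `‖t‖ ≤ R`, so dominated convergence in `k`
  -- yields uniformity on `K`.
  have hlim : Tendsto (fun n => ∑' k, |besselCoeff β k| * R ^ k * (1 - ρ n k)) atTop (𝓝 0) := by
    have := tendsto_tsum_of_dominated_convergence (𝓕 := atTop)
      (f := fun n k => |besselCoeff β k| * R ^ k * (1 - ρ n k)) (g := fun _ => (0 : ℝ)) hs
      (fun k => by
        simpa using ((tendsto_descFactorial_sub_div_pow j k).const_sub 1).const_mul
          (|besselCoeff β k| * R ^ k))
      (Eventually.of_forall fun n k => by
        have h1 := hρ0 n k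
        have h2 := hρ1 n k
        have h3 : 0 ≤ |besselCoeff β k| * R ^ k := by positivity
        rw [Real.norm_of_nonneg (mul_nonneg h3 (by linarith))]
        exact mul_le_of_le_one_right h3 (by linarith))
    simpa using this
  rw [Metric.tendstoUniformlyOn_iff]
  intro ε hε
  filter_upwards [hlim.eventually (gt_mem_nhds hε)] with n hn t ht
  refine lt_of_le_of_lt ?_ hn
  have hb : ∀ k, ‖(besselCoeff β k : ℂ) * t ^ k‖ ≤ |besselCoeff β k| * R ^ k := fun k => by
    rw [norm_mul, norm_pow, Complex.norm_real, Real.norm_eq_abs]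
    gcongr
    exact hR t ht
  have s1 : Summable fun k => (besselCoeff β k : ℂ) * t ^ k := Summable.of_norm_bounded hs hb
  have e : ∀ k, (besselCoeff β k : ℂ) * t ^ k - ((besselCoeff β k * ρ n k : ℝ) : ℂ) * t ^ k =
      ((1 - ρ n k : ℝ) : ℂ) * ((besselCoeff β k : ℂ) * t ^ k) := fun k => by
    push_cast
    ring
  have hb2 : ∀ k, ‖((1 - ρ n k : ℝ) : ℂ) * ((besselCoeff β k : ℂ) * t ^ k)‖ ≤
      |besselCoeff β k| * R ^ k * (1 - ρ n k) := fun k => by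
    rw [norm_mul, Complex.norm_real, Real.norm_of_nonneg (by linarith [hρ1 n k]), mul_comm]
    exact mul_le_mul_of_nonneg_right (hb k) (by linarith [hρ1 n k])
  have s3 : Summable fun k => |besselCoeff β k| * R ^ k * (1 - ρ n k) :=
    Summable.of_nonneg_of_le
      (fun k => mul_nonneg (by positivity) (by linarith [hρ1 n k]))
      (fun k => mul_le_of_le_one_right (by positivity) (by linarith [hρ0 n k])) hs
  have s2 : Summable fun k => ((besselCoeff β k * ρ n k : ℝ) : ℂ) * t ^ k := by
    have := s1.sub (Summable.of_norm_bounded s3 hb2)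
    refine this.congr fun k => ?_
    rw [← e]
    ring
  rw [aeval_scaledLaguerre, besselEntire, dist_eq_norm, ← s1.tsum_sub s2]
  simp only [e]
  exact tsum_of_norm_bounded s3.hasSum hb2

theorem continuous_besselEntire (hβ : -1 < β) : Continuous (besselEntire β) :=
  (tendstoLocallyUniformly_scaledLaguerre hβ 0).continuous
    (Frequently.of_forall fun n => (Polynomial.continuous_aeval _).comp (by fun_prop))

/-! ### Asymptotics of the masses and of the connection coefficients -/

theorem Gamma_add_natCast (hα : 0 < α) (n : ℕ) :
    Real.Gamma (α + n) = Real.Gamma α * ∏ j ∈ Finset.range n, (α + j) := by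
  induction n with
  | zero => simp
  | succ n ih =>
    have : (0 : ℝ) ≤ n := n.cast_nonneg
    rw [Finset.prod_range_succ, ← mul_assoc, ← ih, Nat.cast_succ, ← add_assoc,
      Real.Gamma_add_one (by linarith), mul_comm]

/-- Euler's limit formula for `Γ(α + 1)`, with the product in its denominator rewritten as a
quotient of Gamma values. -/
theorem tendsto_Gamma_div_factorial_mul_rpow (hα : -1 < α) :
    Tendsto (fun n : ℕ => Real.Gamma (α + n + 1) / (n.factorial * (n : ℝ) ^ α)) atTop (𝓝 1) := by
  have hs : 0 < α + 1 := by linarith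
  have hG := (Real.Gamma_pos_of_pos hs).ne'
  have h1 := ((tendsto_const_nhds (x := Real.Gamma (α + 1))).div
    (Real.GammaSeq_tendsto_Gamma (α + 1)) hG).mul (tendsto_natCast_div_add_atTop (α + 1))
  rw [div_self hG, one_mul] at h1
  refine h1.congr' ?_
  filter_upwards [eventually_ge_atTop 1] with n hn
  have hn' : (0 : ℝ) < n := by exact_mod_cast hn
  have e : α + n + 1 = α + 1 + n := by ring
  rw [Pi.div_apply, e, Gamma_add_natCast hs, Real.GammaSeq, Finset.prod_range_succ,
    Real.rpow_add_one hn'.ne']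
  have hp : ∏ j ∈ Finset.range n, (α + 1 + (j : ℝ)) ≠ 0 := Finset.prod_ne_zero_iff.mpr fun j _ => by
    have : (0 : ℝ) ≤ j := j.cast_nonneg
    linarith
  have h2 : (n : ℝ) ^ α ≠ 0 := (Real.rpow_pos_of_pos hn' α).ne'
  have h3 : (α + 1 + n) ≠ 0 := by linarith
  have h4 : (n : ℝ) + (α + 1) ≠ 0 := by linarith
  have h5 : (n.factorial : ℝ) ≠ 0 := by exact_mod_cast n.factorial_ne_zero
  field_simp
  ring

theorem tendsto_natCast_mul_Gamma_div_factorial (hα : -1 < α) :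
    Tendsto (fun n : ℕ => n * Real.Gamma (α + n + 1) / n.factorial) atTop atTop := by
  have h1 : Tendsto (fun n : ℕ => (n : ℝ) ^ (α + 1)) atTop atTop :=
    (tendsto_rpow_atTop (by linarith)).comp tendsto_natCast_atTop_atTop
  refine (h1.atTop_mul_pos one_pos (tendsto_Gamma_div_factorial_mul_rpow hα)).congr' ?_
  filter_upwards [eventually_ge_atTop 1] with n hn
  have hn' : (0 : ℝ) < n := by exact_mod_cast hn
  have h2 : (n : ℝ) ^ α ≠ 0 := (Real.rpow_pos_of_pos hn' α).ne'
  rw [Real.rpow_add_one hn'.ne']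
  field_simp

theorem tendsto_valueMass (hα : -1 < α) (hA : 0 < A) : Tendsto (valueMass α A) atTop atTop := by
  have h1 := Real.Gamma_pos_of_pos (by linarith : 0 < α + 1)
  have h2 := Real.Gamma_pos_of_pos (by linarith : 0 < α + 2)
  refine ((tendsto_natCast_mul_Gamma_div_factorial hα).const_mul_atTop
    (by positivity : 0 < A / (Real.Gamma (α + 1) * Real.Gamma (α + 2)))).congr fun n => ?_
  rw [valueMass]
  field_simp

theorem tendsto_natCast_mul_derivMass (hα : -1 < α) (hB : 0 < B) :
    Tendsto (fun n : ℕ => n * derivMass α B n) atTop atTop := by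
  have h1 := Real.Gamma_pos_of_pos (by linarith : 0 < α + 3)
  have h2 := Real.Gamma_pos_of_pos (by linarith : 0 < α + 4)
  have h3 : Tendsto (fun n : ℕ => (n : ℝ) * ((n : ℝ) - 1)) atTop atTop :=
    tendsto_natCast_atTop_atTop.atTop_mul_atTop₀
      (tendsto_atTop_add_const_right _ _ tendsto_natCast_atTop_atTop)
  refine (h3.atTop_mul_atTop₀ ((tendsto_natCast_mul_Gamma_div_factorial hα).const_mul_atTop
    (by positivity : 0 < B / (Real.Gamma (α + 3) * Real.Gamma (α + 4))))).congr fun n => ?_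
  rw [derivMass]
  field_simp

theorem tendsto_one_add_div_natCast (c : ℝ) :
    Tendsto (fun n : ℕ => ((n : ℝ) + c) / n) atTop (𝓝 1) := by
  have h : Tendsto (fun n : ℕ => 1 + c / (n : ℝ)) atTop (𝓝 (1 + 0)) :=
    tendsto_const_nhds.add (tendsto_const_div_atTop_nhds_zero_nat _)
  rw [add_zero] at h
  refine h.congr' ?_
  filter_upwards [eventually_ge_atTop 1] with n hn
  have hn' : (0 : ℝ) < n := by exact_mod_cast hn
  field_simp

/-- Convergence of the three connection coefficients. -/
def ConnTendsto (α A B a b c : ℝ) : Prop :=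
  Tendsto (connZero α A B) atTop (𝓝 a) ∧ Tendsto (connOne α A B) atTop (𝓝 b) ∧
    Tendsto (connTwo α A B) atTop (𝓝 c)

theorem connTendsto_zero_zero (α : ℝ) : ConnTendsto α 0 0 1 0 0 := by
  have h0 : connZero α 0 0 = fun _ => 1 := by
    ext n; simp [connZero, connDen, valueMass, derivMass]
  have h1 : connOne α 0 0 = fun _ => 0 := by
    ext n; simp [connOne, connDen, valueMass, derivMass]
  have h2 : connTwo α 0 0 = fun _ => 0 := by
    ext n; simp [connTwo, derivMass]
  rw [ConnTendsto, h0, h1, h2]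
  exact ⟨tendsto_const_nhds, tendsto_const_nhds, tendsto_const_nhds⟩

/-- With `V = valueMass`, the coefficients are `1/(1 + V)`, `-V/(1 + V)` and `0`, and `V → ∞`. -/
theorem connTendsto_pos_zero (hα : -1 < α) (hA : 0 < A) : ConnTendsto α A 0 0 (-1) 0 := by
  have hX : Tendsto (fun n : ℕ => (valueMass α A n)⁻¹) atTop (𝓝 0) :=
    tendsto_inv_atTop_zero.comp (tendsto_valueMass hα hA)
  have hD := hX.add_const 1
  rw [zero_add] at hD
  have hpos := (tendsto_valueMass hα hA).eventually_gt_atTop 0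
  refine ⟨?_, ?_, ?_⟩
  · have := hX.div hD one_ne_zero
    rw [zero_div] at this
    refine this.congr' ?_
    filter_upwards [hpos] with n hn
    simp only [Pi.div_apply, connZero, connDen, derivMass]
    field_simp
    ring
  · have := (tendsto_const_nhds (x := (-1 : ℝ))).div hD one_ne_zero
    rw [div_one] at this
    refine this.congr' ?_
    filter_upwards [hpos] with n hn
    simp only [Pi.div_apply, connOne, connDen, derivMass]
    field_simp
    ring
  · have h2 : connTwo α A 0 = fun _ => 0 := by
      ext n; simp [connTwo, derivMass]
    rw [h2]
    exact tendsto_const_nhds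

/-- The one regime where all three terms survive. After division by `n * derivMass` the numerators
tend to `-(α + 2)`, `-(α + 2)²`, `α + 2` and the denominator to `(α + 2)²`. -/
theorem connTendsto_zero_pos (hα : -1 < α) (hB : 0 < B) :
    ConnTendsto α 0 B (-(α + 2)⁻¹) (-1) (α + 2)⁻¹ := by
  have hY : Tendsto (fun n : ℕ => (n * derivMass α B n)⁻¹) atTop (𝓝 0) :=
    tendsto_inv_atTop_zero.comp (tendsto_natCast_mul_derivMass hα hB)
  have hε : Tendsto (fun n : ℕ => (n : ℝ)⁻¹) atTop (𝓝 0) :=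
    tendsto_inv_atTop_zero.comp tendsto_natCast_atTop_atTop
  have h2 : α + 2 ≠ 0 := by linarith
  have hD : Tendsto (fun n : ℕ => (n * derivMass α B n)⁻¹ +
      (α + 2) * ((α + 2) - (α + 1) * (n : ℝ)⁻¹)) atTop (𝓝 ((α + 2) ^ 2)) := by
    have := hY.add (((hε.const_mul (α + 1)).const_sub (α + 2)).const_mul (α + 2))
    convert this using 2
    ring
  have hD0 : (α + 2) ^ 2 ≠ 0 := pow_ne_zero 2 h2
  have hpos : ∀ᶠ n : ℕ in atTop, (0 : ℝ) < n ∧ derivMass α B n ≠ 0 := by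
    filter_upwards [(tendsto_natCast_mul_derivMass hα hB).eventually_gt_atTop 0,
      eventually_ge_atTop 1] with n hn h1
    exact ⟨by exact_mod_cast h1, fun h => by simp [h] at hn⟩
  have hden : ∀ᶠ n : ℕ in atTop, connDen α 0 B n = n * derivMass α B n *
      ((n * derivMass α B n)⁻¹ + (α + 2) * ((α + 2) - (α + 1) * (n : ℝ)⁻¹)) := by
    filter_upwards [hpos] with n ⟨hn, hW⟩
    simp only [connDen, valueMass]
    field_simp
    ring
  have hne := hD.eventually_ne hD0
  refine ⟨?_, ?_, ?_⟩
  · have := (hY.sub (((hε.const_mul (α + 1)).const_add 1).const_mul (α + 2))).div hD hD0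
    rw [show (0 - (α + 2) * (1 + (α + 1) * 0)) / (α + 2) ^ 2 = -(α + 2)⁻¹ by
      field_simp; ring] at this
    refine this.congr' ?_
    filter_upwards [hpos, hden, hne] with n ⟨hn, hW⟩ hd hn0
    rw [Pi.div_apply, connZero, hd, eq_div_iff (by positivity), div_mul_eq_mul_div,
      div_eq_iff hn0]
    field_simp
    ring
  · have := (tendsto_const_nhds (x := -(α + 2) ^ 2)).div hD hD0
    rw [neg_div, div_self hD0] at this
    refine this.congr' ?_
    filter_upwards [hpos, hden, hne] with n ⟨hn, hW⟩ hd hn0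
    rw [Pi.div_apply, connOne, hd, eq_div_iff (by positivity), div_mul_eq_mul_div,
      div_eq_iff hn0, valueMass]
    ring
  · have := (tendsto_const_nhds (x := α + 2)).div hD hD0
    rw [show (α + 2) / (α + 2) ^ 2 = (α + 2)⁻¹ by field_simp] at this
    refine this.congr' ?_
    filter_upwards [hpos, hden, hne] with n ⟨hn, hW⟩ hd hn0
    rw [Pi.div_apply, connTwo, hd, eq_div_iff (by positivity), div_mul_eq_mul_div,
      div_eq_iff hn0, valueMass]
    ring

/-- The dominant term of `connDen` is `(n + α + 1) * derivMass * valueMass`, and only the numerator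
of `connTwo` contains it. -/
theorem connTendsto_pos_pos (hα : -1 < α) (hA : 0 < A) (hB : 0 < B) :
    ConnTendsto α A B 0 0 1 := by
  have hX : Tendsto (fun n : ℕ => (valueMass α A n)⁻¹) atTop (𝓝 0) :=
    tendsto_inv_atTop_zero.comp (tendsto_valueMass hα hA)
  have hY : Tendsto (fun n : ℕ => (n * derivMass α B n)⁻¹) atTop (𝓝 0) :=
    tendsto_inv_atTop_zero.comp (tendsto_natCast_mul_derivMass hα hB)
  have hε : Tendsto (fun n : ℕ => (n : ℝ)⁻¹) atTop (𝓝 0) :=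
    tendsto_inv_atTop_zero.comp tendsto_natCast_atTop_atTop
  have hD : Tendsto (fun n : ℕ => (valueMass α A n)⁻¹ * (n * derivMass α B n)⁻¹ +
      (n * derivMass α B n)⁻¹ +
      (α + 2) * ((α + 2) - (α + 1) * (n : ℝ)⁻¹) * (valueMass α A n)⁻¹ +
      (1 + (α + 1) * (n : ℝ)⁻¹)) atTop (𝓝 1) := by
    have := (((hX.mul hY).add hY).add
      ((((hε.const_mul (α + 1)).const_sub (α + 2)).const_mul (α + 2)).mul hX)).add
      ((hε.const_mul (α + 1)).const_add 1)
    convert this using 2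
    ring
  have hpos : ∀ᶠ n : ℕ in atTop, (0 : ℝ) < n ∧ derivMass α B n ≠ 0 ∧ valueMass α A n ≠ 0 := by
    filter_upwards [(tendsto_natCast_mul_derivMass hα hB).eventually_gt_atTop 0,
      eventually_ge_atTop 1, (tendsto_valueMass hα hA).eventually_gt_atTop 0] with n hn h1 h2
    exact ⟨by exact_mod_cast h1, fun h => by simp [h] at hn, h2.ne'⟩
  have hden : ∀ᶠ n : ℕ in atTop, connDen α A B n = n * derivMass α B n * valueMass α A n *
      ((valueMass α A n)⁻¹ * (n * derivMass α B n)⁻¹ + (n * derivMass α B n)⁻¹ +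
      (α + 2) * ((α + 2) - (α + 1) * (n : ℝ)⁻¹) * (valueMass α A n)⁻¹ +
      (1 + (α + 1) * (n : ℝ)⁻¹)) := by
    filter_upwards [hpos] with n ⟨hn, hW, hV⟩
    simp only [connDen]
    field_simp
    ring
  have hne := hD.eventually_ne one_ne_zero
  refine ⟨?_, ?_, ?_⟩
  · have := ((hX.mul hY).sub
      ((((hε.const_mul (α + 1)).const_add 1).const_mul (α + 2)).mul hX)).div hD one_ne_zero
    simp only [mul_zero, sub_zero, zero_div] at this
    refine this.congr' ?_
    filter_upwards [hpos, hden, hne] with n ⟨hn, hW, hV⟩ hd hn0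
    rw [Pi.div_apply, connZero, hd, eq_div_iff (by positivity), div_mul_eq_mul_div,
      div_eq_iff hn0]
    field_simp
    ring
  · have := (hY.add (hX.const_mul ((α + 2) ^ 2))).neg.div hD one_ne_zero
    simp only [mul_zero, add_zero, neg_zero, zero_div] at this
    refine this.congr' ?_
    filter_upwards [hpos, hden, hne] with n ⟨hn, hW, hV⟩ hd hn0
    rw [Pi.div_apply, connOne, hd, eq_div_iff (by positivity), div_mul_eq_mul_div,
      div_eq_iff hn0]
    field_simp
  · have := ((hX.const_mul (α + 2)).add ((hε.const_mul (α + 1)).const_add 1)).div hD one_ne_zero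
    simp only [mul_zero, add_zero, zero_add, div_one] at this
    refine this.congr' ?_
    filter_upwards [hpos, hden, hne] with n ⟨hn, hW, hV⟩ hd hn0
    rw [Pi.div_apply, connTwo, hd, eq_div_iff (by positivity), div_mul_eq_mul_div,
      div_eq_iff hn0]
    field_simp
    ring

/-! ### Locally uniform limit of the Laguerre-Sobolev polynomials -/

theorem tendstoLocallyUniformly_const_of_tendsto {u : ℕ → ℝ} {l : ℝ}
    (h : Tendsto u atTop (𝓝 l)) :
    TendstoLocallyUniformly (fun (n : ℕ) (_ : ℂ) => (u n : ℂ)) (fun _ => (l : ℂ)) atTop := by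
  refine TendstoUniformly.tendstoLocallyUniformly ?_
  rw [Metric.tendstoUniformly_iff]
  intro ε hε
  filter_upwards [Metric.tendsto_nhds.mp h ε hε] with n hn _
  rwa [Complex.dist_eq, ← Complex.ofReal_sub, Complex.norm_real, ← dist_eq_norm, dist_comm]

theorem TendstoLocallyUniformly.congr_of_eventually {f g : ℕ → ℂ → ℂ} {F : ℂ → ℂ}
    (h : TendstoLocallyUniformly f F atTop) (hfg : ∀ᶠ n in atTop, f n = g n) :
    TendstoLocallyUniformly g F atTop := by
  intro u hu x
  obtain ⟨t, ht, h'⟩ := h u hu x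
  refine ⟨t, ht, ?_⟩
  filter_upwards [h', hfg] with n h1 h2 y hy
  rw [← h2]
  exact h1 y hy

/-- The limit function, in terms of the limits of the connection coefficients. -/
def limitEntire (α a b c : ℝ) (t : ℂ) : ℂ :=
  a * besselEntire α t + b * (t * besselEntire (α + 2) t) + c * (t ^ 2 * besselEntire (α + 4) t)

theorem continuous_limitEntire (hα : -1 < α) (a b c : ℝ) : Continuous (limitEntire α a b c) := by
  have h0 := continuous_besselEntire hα
  have h1 := continuous_besselEntire (show -1 < α + 2 by linarith)
  have h2 := continuous_besselEntire (show -1 < α + 4 by linarith)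
  unfold limitEntire
  fun_prop

/-- Mehler-Heine asymptotics of the monic orthogonal polynomials `laguerreSobolev`. -/
theorem tendstoLocallyUniformly_laguerreSobolev (hα : -1 < α) {a b c : ℝ}
    (h : ConnTendsto α A B a b c) :
    TendstoLocallyUniformly (fun (n : ℕ) (t : ℂ) =>
      (((-1) ^ n / (n.factorial * (n : ℝ) ^ α) : ℝ) : ℂ) * aeval (t / n) (laguerreSobolev α A B n))
      (limitEntire α a b c) atTop := by
  have c0 := continuous_besselEntire hα
  have c1 := continuous_besselEntire (show -1 < α + 2 by linarith)
  have c2 := continuous_besselEntire (show -1 < α + 4 by linarith)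
  have t0 := tendstoLocallyUniformly_scaledLaguerre hα 0
  have t1 := tendstoLocallyUniformly_scaledLaguerre (show -1 < α + 2 by linarith) 1
  have t2 := tendstoLocallyUniformly_scaledLaguerre (show -1 < α + 4 by linarith) 2
  have tid : TendstoLocallyUniformly (fun (_ : ℕ) (t : ℂ) => t) (fun t => t) atTop := by
    intro u hu x
    exact ⟨Set.univ, univ_mem, Eventually.of_forall fun _ y _ => refl_mem_uniformity hu⟩
  have hE := tendstoLocallyUniformly_const_of_tendsto (tendsto_Gamma_div_factorial_mul_rpow hα)
  have ha := tendstoLocallyUniformly_const_of_tendsto h.1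
  -- Evaluating `X` at `t / n` gives a factor `1 / n`, balanced by the `n + α + 1` in
  -- `laguerreSobolev`; likewise for `X ^ 2` in `hc`.
  have hb := tendstoLocallyUniformly_const_of_tendsto
    ((tendsto_one_add_div_natCast (α + 1)).mul h.2.1)
  have hc := tendstoLocallyUniformly_const_of_tendsto
    (((tendsto_one_add_div_natCast (α + 1)).mul (tendsto_one_add_div_natCast (α + 2))).mul h.2.2)
  simp only [one_mul] at hb hc
  have u0 := ha.fun_mul₀ t0 continuous_const c0
  have u1 := hb.fun_mul₀ (tid.fun_mul₀ t1 continuous_id c1) continuous_const (by fun_prop)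
  have u2 := hc.fun_mul₀ ((tid.fun_mul₀ tid continuous_id continuous_id).fun_mul₀ t2 (by fun_prop) c2)
    continuous_const (by fun_prop)
  have key := hE.fun_mul₀ ((u0.add u1).add u2) continuous_const (by fun_prop)
  have e : (fun t : ℂ => ((1 : ℝ) : ℂ) * (((fun t => (a : ℂ) * besselEntire α t) + fun t =>
      (b : ℂ) * (t * besselEntire (α + 2) t)) + fun t =>
      (c : ℂ) * (t * t * besselEntire (α + 4) t)) t) = limitEntire α a b c := by
    funext t
    simp only [limitEntire, Pi.add_apply]
    push_cast
    ring
  rw [← e]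
  refine key.congr_of_eventually ?_
  filter_upwards [eventually_ge_atTop 1] with n hn
  have hn0 : (n : ℂ) ≠ 0 := by exact_mod_cast (by omega : n ≠ 0)
  have hs : ((-1 : ℂ) ^ n) ^ 2 = 1 := by rw [← pow_mul, mul_comm, pow_mul]; simp
  funext t
  simp only [laguerreSobolev, map_mul, map_add, aeval_C, aeval_X, map_pow, Pi.add_apply,
    Complex.coe_algebraMap, Nat.sub_zero, map_neg, map_one]
  push_cast
  generalize aeval (t / n) (scaledLaguerre α n) = p0
  generalize aeval (t / n) (scaledLaguerre (α + 2) (n - 1)) = p1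
  generalize aeval (t / n) (scaledLaguerre (α + 4) (n - 2)) = p2
  generalize (((n : ℝ) ^ α : ℝ) : ℂ) = q
  rw [show ∀ G F Y : ℂ, (-1) ^ n / F * ((-1) ^ n * G * Y) = ((-1) ^ n) ^ 2 * (G / F * Y) from
    fun G F Y => by ring, hs, one_mul]
  congr 1
  field_simp
  ring

/-! ### Bessel functions of half-integer order and the scaled limits -/

/-- For `β + 1/2` a natural number the two fractional powers of `z / 2` combine into an integral
one, so the branch disappears. -/
theorem cpow_half_mul_besselJ (β : ℝ) (e : ℕ) (he : β + 1 / 2 = e) {z : ℂ} (hz : z ≠ 0) :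
    (z / 2) ^ (1 / 2 : ℂ) * besselJ β z = (z / 2) ^ e * besselEntire β (z ^ 2 / 4) := by
  have hw : z / 2 ≠ 0 := div_ne_zero hz two_ne_zero
  rw [besselJ, besselEntire, ← tsum_mul_left, ← tsum_mul_left]
  refine tsum_congr fun k => ?_
  have h1 : (z / 2) ^ (1 / 2 : ℂ) * (z / 2) ^ (((2 * k + β : ℝ)) : ℂ) =
      (z / 2) ^ e * (z ^ 2 / 4) ^ k := by
    have : (1 / 2 : ℂ) + ((2 * k + β : ℝ) : ℂ) = ((e + 2 * k : ℕ) : ℂ) := by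
      have : (1 / 2 : ℝ) + (2 * k + β) = ((e + 2 * k : ℕ) : ℝ) := by
        push_cast; linarith
      rw [← Complex.ofReal_natCast, ← this]
      push_cast
      ring
    rw [← Complex.cpow_add _ _ hw, this, Complex.cpow_natCast, pow_add, pow_mul, div_pow z 2 2]
    norm_num
  rw [besselCoeff, show β + 1 + (k : ℝ) = k + β + 1 by ring]
  rw [Complex.ofReal_div, Complex.ofReal_mul, Complex.ofReal_pow, Complex.ofReal_neg,
    Complex.ofReal_one, Complex.ofReal_natCast]
  linear_combination ((-1) ^ k / ((k.factorial : ℂ) * (Real.Gamma (k + β + 1) : ℂ))) * h1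

/-- Weierstrass: a locally uniform limit of entire functions is entire, so `F` removes the
singularity of `g`. -/
theorem tendstoUniformlyOnCompactsTo_of_tendstoLocallyUniformly {f : ℕ → ℂ → ℂ} {F g : ℂ → ℂ}
    (hf : ∀ n, Differentiable ℂ (f n)) (h : TendstoLocallyUniformly f F atTop)
    (hg : ∀ z, z ≠ 0 → F z = g z) : TendstoUniformlyOnCompactsTo f g := by
  refine ⟨F, ?_, hg, tendstoLocallyUniformly_iff_forall_isCompact.mp h⟩
  rw [← differentiableOn_univ]
  exact (tendstoLocallyUniformlyOn_univ.mpr h).differentiableOn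
    (Eventually.of_forall fun n => (hf n).differentiableOn) isOpen_univ

theorem div_two_mul_sqrt_sq (n : ℕ) (z : ℂ) :
    (z / (2 * (√(n : ℝ) : ℂ))) ^ 2 = z ^ 2 / 4 / n := by
  have : ((√(n : ℝ) : ℂ)) ^ 2 = n := by
    rw [← Complex.ofReal_pow, Real.sq_sqrt n.cast_nonneg, Complex.ofReal_natCast]
  rw [div_pow, mul_pow, this, div_div]
  norm_num

variable {S : ℕ → ℝ[X]}

theorem scaledEven_tendsto (hM : ∀ i, 0 ≤ M i) (hS : IsMonicOrthogonalSequence M S) {a b c : ℝ}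
    (h : ConnTendsto (-1 / 2) (M 0) (4 * M 2) a b c) {g : ℂ → ℂ}
    (hg : ∀ z, z ≠ 0 → limitEntire (-1 / 2) a b c (z ^ 2 / 4) = g z) :
    TendstoUniformlyOnCompactsTo (scaledEven S) g := by
  refine tendstoUniformlyOnCompactsTo_of_tendstoLocallyUniformly (fun n => ?_) ?_ hg
  · unfold scaledEven
    have h1 : Differentiable ℂ fun z : ℂ => z / (2 * (√(n : ℝ) : ℂ)) := by fun_prop
    exact ((Polynomial.differentiable_aeval (S (2 * n))).comp h1).const_mul _
  · have key := (tendstoLocallyUniformly_laguerreSobolev (by norm_num) h).comp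
      (fun z : ℂ => z ^ 2 / 4) (by fun_prop)
    refine key.congr_of_eventually ?_
    filter_upwards [eventually_ge_atTop 2] with n hn
    funext z
    simp only [Function.comp_apply, scaledEven]
    rw [hS.even_eq hM hn, expand_aeval, div_two_mul_sqrt_sq]
    congr 1
    -- The factor `√n` in `scaledEven` is `n ^ (-α)` for `α = -1/2`.
    rw [show (-1 / 2 : ℝ) = -(1 / 2) by norm_num, Real.rpow_neg n.cast_nonneg, ← Real.sqrt_eq_rpow]
    push_cast
    rw [div_mul_eq_div_div, div_inv_eq_mul, div_mul_eq_mul_div]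

theorem scaledOdd_tendsto (hM : ∀ i, 0 ≤ M i) (hS : IsMonicOrthogonalSequence M S) {a b c : ℝ}
    (h : ConnTendsto (1 / 2) (M 1) (36 * M 3) a b c) {g : ℂ → ℂ}
    (hg : ∀ z, z ≠ 0 → z / 2 * limitEntire (1 / 2) a b c (z ^ 2 / 4) = g z) :
    TendstoUniformlyOnCompactsTo (scaledOdd S) g := by
  refine tendstoUniformlyOnCompactsTo_of_tendstoLocallyUniformly (fun n => ?_) ?_ hg
  · unfold scaledOdd
    have h1 : Differentiable ℂ fun z : ℂ => z / (2 * (√(n : ℝ) : ℂ)) := by fun_prop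
    exact ((Polynomial.differentiable_aeval (S (2 * n + 1))).comp h1).const_mul _
  · have key := (tendstoLocallyUniformly_laguerreSobolev (by norm_num) h).comp
      (fun z : ℂ => z ^ 2 / 4) (by fun_prop)
    have tid : TendstoLocallyUniformly (fun (_ : ℕ) (z : ℂ) => z / 2) (fun z => z / 2) atTop := by
      intro u hu x
      exact ⟨Set.univ, univ_mem, Eventually.of_forall fun _ y _ => refl_mem_uniformity hu⟩
    -- The outer factor `X` evaluates to `(z / 2) / √n`; its `1 / √n` is the `n ^ (-α)` for `α =
    -- 1/2`, so `scaledOdd` carries no root.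
    have key2 := tid.fun_mul₀ key (by fun_prop)
      ((continuous_limitEntire (by norm_num) a b c).comp (by fun_prop))
    refine key2.congr_of_eventually ?_
    filter_upwards [eventually_ge_atTop 2] with n hn
    funext z
    simp only [Function.comp_apply, scaledOdd]
    rw [hS.odd_eq hM hn, map_mul, aeval_X, expand_aeval, div_two_mul_sqrt_sq, ← Real.sqrt_eq_rpow]
    push_cast
    ring

end

theorem theorem2 (M : Fin 4 → ℝ) (hM : ∀ i, 0 ≤ M i)
    (S : ℕ → ℝ[X]) (hS : IsMonicOrthogonalSequence M S) :
    ((M 0 = 0 ∧ M 2 = 0 → TendstoUniformlyOnCompactsTo (scaledEven S)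
        (fun z => (z / 2) ^ (1 / 2 : ℂ) * besselJ (-1 / 2) z)) ∧
      (0 < M 0 ∧ M 2 = 0 → TendstoUniformlyOnCompactsTo (scaledEven S)
        (fun z => -((z / 2) ^ (1 / 2 : ℂ) * besselJ (3 / 2) z))) ∧
      (M 0 = 0 ∧ 0 < M 2 → TendstoUniformlyOnCompactsTo (scaledEven S)
        (fun z => (z / 2) ^ (1 / 2 : ℂ) *
          ((2 / 3) * besselJ (7 / 2) z - besselJ (3 / 2) z - (2 / 3) * besselJ (-1 / 2) z))) ∧
      (0 < M 0 ∧ 0 < M 2 → TendstoUniformlyOnCompactsTo (scaledEven S)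
        (fun z => (z / 2) ^ (1 / 2 : ℂ) * besselJ (7 / 2) z))) ∧
    ((M 1 = 0 ∧ M 3 = 0 → TendstoUniformlyOnCompactsTo (scaledOdd S)
        (fun z => (z / 2) ^ (1 / 2 : ℂ) * besselJ (1 / 2) z)) ∧
      (0 < M 1 ∧ M 3 = 0 → TendstoUniformlyOnCompactsTo (scaledOdd S)
        (fun z => -((z / 2) ^ (1 / 2 : ℂ) * besselJ (5 / 2) z))) ∧
      (M 1 = 0 ∧ 0 < M 3 → TendstoUniformlyOnCompactsTo (scaledOdd S)
        (fun z => (z / 2) ^ (1 / 2 : ℂ) *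
          ((2 / 5) * besselJ (9 / 2) z - besselJ (5 / 2) z - (2 / 5) * besselJ (1 / 2) z))) ∧
      (0 < M 1 ∧ 0 < M 3 → TendstoUniformlyOnCompactsTo (scaledOdd S)
        (fun z => (z / 2) ^ (1 / 2 : ℂ) * besselJ (9 / 2) z))) := by
  have j0 := fun z (hz : z ≠ 0) => cpow_half_mul_besselJ (-1 / 2) 0 (by norm_num) hz
  have j1 := fun z (hz : z ≠ 0) => cpow_half_mul_besselJ (1 / 2) 1 (by norm_num) hz
  have j2 := fun z (hz : z ≠ 0) => cpow_half_mul_besselJ (3 / 2) 2 (by norm_num) hz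
  have j3 := fun z (hz : z ≠ 0) => cpow_half_mul_besselJ (5 / 2) 3 (by norm_num) hz
  have j4 := fun z (hz : z ≠ 0) => cpow_half_mul_besselJ (7 / 2) 4 (by norm_num) hz
  have j5 := fun z (hz : z ≠ 0) => cpow_half_mul_besselJ (9 / 2) 5 (by norm_num) hz
  have hα : (-1 : ℝ) < -1 / 2 := by norm_num
  have hα' : (-1 : ℝ) < 1 / 2 := by norm_num
  have n1 : (-1 / 2 + 2 : ℝ) = 3 / 2 := by norm_num
  have n2 : (-1 / 2 + 4 : ℝ) = 7 / 2 := by norm_num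
  have n3 : (1 / 2 + 2 : ℝ) = 5 / 2 := by norm_num
  have n4 : (1 / 2 + 4 : ℝ) = 9 / 2 := by norm_num
  refine ⟨⟨fun h => ?_, fun h => ?_, fun h => ?_, fun h => ?_⟩,
    ⟨fun h => ?_, fun h => ?_, fun h => ?_, fun h => ?_⟩⟩
  · have hc := connTendsto_zero_zero (-1 / 2)
    refine scaledEven_tendsto hM hS (a := 1) (b := 0) (c := 0)
      (by rw [h.1, h.2, mul_zero]; exact hc) fun z hz => ?_
    rw [j0 z hz, limitEntire, n1, n2]
    push_cast
    ring
  · have hc := connTendsto_pos_zero hα h.1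
    refine scaledEven_tendsto hM hS (a := 0) (b := -1) (c := 0)
      (by rw [h.2, mul_zero]; exact hc) fun z hz => ?_
    rw [j2 z hz, limitEntire, n1, n2]
    push_cast
    ring
  · have hc := connTendsto_zero_pos hα (mul_pos (by norm_num : (0 : ℝ) < 4) h.2)
    refine scaledEven_tendsto hM hS (by rw [h.1]; exact hc) fun z hz => ?_
    rw [limitEntire, n1, n2]
    push_cast
    -- Here `2 / 3` is `(α + 2)⁻¹` at `α = -1/2`; at `α = 1/2` it becomes `2 / 5`.
    linear_combination -(2 / 3 : ℂ) * j4 z hz + j2 z hz + (2 / 3 : ℂ) * j0 z hz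
  · have hc := connTendsto_pos_pos hα h.1 (mul_pos (by norm_num : (0 : ℝ) < 4) h.2)
    refine scaledEven_tendsto hM hS hc fun z hz => ?_
    rw [j4 z hz, limitEntire, n1, n2]
    push_cast
    ring
  · have hc := connTendsto_zero_zero (1 / 2)
    refine scaledOdd_tendsto hM hS (a := 1) (b := 0) (c := 0)
      (by rw [h.1, h.2, mul_zero]; exact hc) fun z hz => ?_
    rw [j1 z hz, limitEntire, n3, n4]
    push_cast
    ring
  · have hc := connTendsto_pos_zero hα' h.1
    refine scaledOdd_tendsto hM hS (a := 0) (b := -1) (c := 0)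
      (by rw [h.2, mul_zero]; exact hc) fun z hz => ?_
    rw [j3 z hz, limitEntire, n3, n4]
    push_cast
    ring
  · have hc := connTendsto_zero_pos hα' (mul_pos (by norm_num : (0 : ℝ) < 36) h.2)
    refine scaledOdd_tendsto hM hS (by rw [h.1]; exact hc) fun z hz => ?_
    rw [limitEntire, n3, n4]
    push_cast
    linear_combination -(2 / 5 : ℂ) * j5 z hz + j3 z hz + (2 / 5 : ℂ) * j1 z hz
  · have hc := connTendsto_pos_pos hα' h.1 (mul_pos (by norm_num : (0 : ℝ) < 36) h.2)
    refine scaledOdd_tendsto hM hS hc fun z hz => ?_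
    rw [j5 z hz, limitEntire, n3, n4]
    push_cast
    ring
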